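/- All registers are finite-dimensional and $\log$ is to base $2$. For positive semidefinite, possibly subnormalized operators put $H(\rho)=-\operatorname{Tr}(\rho\log_2\rho)$ and $D(\rho\|\sigma)=\operatorname{Tr}(\rho\log_2\rho)-\operatorname{Tr}(\rho\log_2\sigma)$ if $\operatorname{supp}\rho\subseteq\operatorname{supp}\sigma$, and $D(\rho\|\sigma)=+\infty$ otherwise. **Data of one round.** Alice and Bob have POVMs $\{P^A_x\}_{x\in\mathcal X}$ on $A$ and $\{P^B_y\}_{y\in\mathcal Y}$ on $B$ with finite outcome sets, partitioned by announcements as $\mathcal X=\bigsqcup_{a\in S^A}\mathcal X_a$, $\mathcal Y=\bigsqcup_{b\in S^B}\mathcal Y_b$, where $S^A,S^B$ are finite, $|\mathcal X_a|=\omega_A$, $|\mathcal Y_b|=\omega_B$, with bijections $f_a:\Omega^A=\{1,\dots,\omega_A\}\to\mathcal X_a$ and $f_b:\Omega^B=\{1,\dots,\omega_B\}\to\mathcal Y_b$. A set $\mathbf K\subseteq S^A\times S^B$ of announcements is kept and its complement $\mathbf D$ is discarded. The (reverse-reconciliation) key map $g$ sends $(a,b)\in S^A\times S^B$ and $y\in\mathcal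 Y_b$ to $g(a,b,y)\in\{0,\dots,N-1\}$. The key register $R$ has orthonormal basis $|0\rangle,\dots,|N-1\rangle,|\perp\rangle$; the registers $\widetilde A,E_{\widetilde A}$ have basis $S^A$, $\widetilde B,E_{\widetilde B}$ have basis $S^B$, $\overline A,\overline B$ have bases $\Omega^A,\Omega^B$, and $S,E_S$ have basis $|\mathbf K\rangle,|\mathbf D\rangle$. Write $[A]=A\widetilde A\overline A$, $[B]=B\widetilde B\overline B$, $[E]=EE_{\widetilde A}E_{\widetilde B}E_S$. Identities on unspecified registers are omitted and registers may be reordered. Define $$K_a^A=\sum_{\alpha\in\Omega^A}\sqrt{P^A_{f_a(\alpha)}}\otimes|a\rangle_{\widetilde A}\otimes|\alpha\rangle_{\overline A},\qquad K_b^B=\sum_{\beta\in\Omega^B}\sqrt{P^B_{f_b(\beta)}}\otimes|b\rangle_{\widetilde B}\otimes|\beta\rangle_{\overline B},$$ $$W_A=\sum_{a}K_a^A\otimes|a\rangle_{E_{\widetilde A}},\quad W_B=\sum_{b}K_b^B\otimes|b\rangle_{E_{\widetilde B}},\quad \Pi=\sum_{(a,b)\in\mathbf K}|a\rangle\langle a|_{\widetilde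 A}\otimes|b\rangle\langle b|_{\widetilde B},$$ $$V_S=\Pi\otimes|\mathbf K\rangle_S\otimes|\mathbf K\rangle_{E_S}+(1-\Pi)\otimes|\mathbf D\rangle_S\otimes|\mathbf D\rangle_{E_S},$$ $$V=\sum_{(a,b)\in\mathbf K,\ \beta\in\Omega^B}|g(a,b,f_b(\beta))\rangle_R\otimes|a\rangle\langle a|_{\widetilde A}\otimes|b\rangle\langle b|_{\widetilde B}\otimes|\beta\rangle\langle\beta|_{\overline B},\qquad V_K=V\Pi+|\perp\rangle_R\otimes(1-\Pi),$$ $$\mathcal A(\sigma)=\sum_{a\in S^A}\sum_{b\in S^B}(K_a^A\otimes K_b^B)\,\sigma\,(K_a^A\otimes K_b^B)^\dagger,\qquad \mathcal G(\sigma)=V\Pi\,\mathcal A(\sigma)\,\Pi V^\dagger,$$ $Z_j=|j\rangle\langle j|_R$ for $j\in\{0,\dots,N-1,\perp\}$, and $\mathcal Z(\tau)=\sum_jZ_j\tau Z_j$. **States.** Let $\rho_{AB}$ be a density operator, $\rho_{ABE}=|\psi\rangle\langle\psi|$ a purification of it, and $$\rho^{(3)}_{R[A][B]S[E]}=V_KV_S(W_A\otimes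 W_B)\,\rho_{ABE}\,(W_A\otimes W_B)^\dagger V_S^\dagger V_K^\dagger .$$ Let $\rho^{(3)}_{R[A][B]S}=\operatorname{Tr}_{[E]}\rho^{(3)}_{R[A][B]S[E]}$ and $H(\mathbf Z|[E])=H(\rho_{\mathbf Z[E]})-H(\rho_{[E]})$, where $\rho_{[E]}=\operatorname{Tr}_{R[A][B]S}\rho^{(3)}_{R[A][B]S[E]}$ and $\rho_{\mathbf Z[E]}=\sum_j|j\rangle\langle j|\otimes\operatorname{Tr}_{R[A][B]S}\big[Z_j\rho^{(3)}_{R[A][B]S[E]}Z_j\big]$. Let $p_{\rm pass}=\operatorname{Tr}(\mathcal A(\rho_{AB})\Pi)$ and $$\rho^{\mathbf K}=\frac{\mathcal G(\rho_{AB})}{p_{\rm pass}},\qquad \rho^{\mathbf D}=\frac{|\perp\rangle\langle\perp|_R\otimes(1-\Pi)\mathcal A(\rho_{AB})(1-\Pi)}{1-p_{\rm pass}},$$ where a quotient with denominator $0$ is read as the zero operator. **Claim.** The number $p_{\rm pass}$ is real, $p_{\rm pass}=\operatorname{Tr}\mathcal G(\rho_{AB})$, $$\rho^{(3)}_{R[A][B]S}=p_{\rm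 pass}\,\rho^{\mathbf K}\otimes|\mathbf K\rangle\langle\mathbf K|_S+(1-p_{\rm pass})\,\rho^{\mathbf D}\otimes|\mathbf D\rangle\langle\mathbf D|_S ,$$ and $$\begin{aligned}H(\mathbf Z|[E])&=D\big(\rho^{(3)}_{R[A][B]S}\,\big\|\,\mathcal Z(\rho^{(3)}_{R[A][B]S})\big)\\&=p_{\rm pass}D\big(\rho^{\mathbf K}\|\mathcal Z(\rho^{\mathbf K})\big)+(1-p_{\rm pass})D\big(\rho^{\mathbf D}\|\mathcal Z(\rho^{\mathbf D})\big)\\&=p_{\rm pass}D\big(\rho^{\mathbf K}\|\mathcal Z(\rho^{\mathbf K})\big)=D\big(\mathcal G(\rho_{AB})\,\big\|\,\mathcal Z[\mathcal G(\rho_{AB})]\big).\end{aligned}$$ The discarded events contribute nothing: $\mathcal Z(\rho^{\mathbf D})=\rho^{\mathbf D}$ and $D(\rho^{\mathbf D}\|\rho^{\mathbf D})=0$. The symbol $\perp$ can be dropped from the pinching: $\sum_{j=0}^{N-1}Z_j\,\mathcal G(\rho_{AB})\,Z_j=\mathcal Z[\mathcal G(\rho_{AB})]$. -/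

import Mathlib

open scoped ComplexOrder Kronecker

noncomputable section

namespace QKD

/-! ### Linear algebra on finite-dimensional registers

A register with orthonormal basis indexed by a finite type `n` is the space `ℂ^n`; a composite
register is indexed by the product type, and operators are complex matrices. -/

section LinearAlgebra

variable {k m n : Type*}

/-- The basis vector `|i⟩`. -/
def ket [DecidableEq k] (i : k) : k → ℂ := Pi.single i 1

/-- The rank-one projector `|i⟩⟨i|`. -/
def proj [DecidableEq k] (i : k) : Matrix k k ℂ := Matrix.single i i 1

/-- `M ⊗ |v⟩`, the new register being written on the right. -/
def tensorKet (M : Matrix m n ℂ) (v : k → ℂ) : Matrix (m × k) n ℂ :=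
  Matrix.of fun p j => M p.1 j * v p.2

/-- `|v⟩ ⊗ M`, the new register being written on the left. -/
def ketTensor (v : k → ℂ) (M : Matrix m n ℂ) : Matrix (k × m) n ℂ :=
  Matrix.of fun p j => v p.1 * M p.2 j

/-- The operator `|ψ⟩⟨ψ|`. -/
def pureState (ψ : n → ℂ) : Matrix n n ℂ := Matrix.vecMulVec ψ (star ψ)

/-- Partial trace over the right-hand register. -/
def traceRight [Fintype n] (ρ : Matrix (m × n) (m × n) ℂ) : Matrix m m ℂ :=
  Matrix.of fun i j => ∑ l, ρ (i, l) (j, l)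

/-- Partial trace over the left-hand register. -/
def traceLeft [Fintype m] (ρ : Matrix (m × n) (m × n) ℂ) : Matrix n n ℂ :=
  Matrix.of fun i j => ∑ l, ρ (l, i) (l, j)

variable [Fintype n] [DecidableEq n]

/-- Density operators: positive semidefinite with unit trace. -/
def IsDensity (ρ : Matrix n n ℂ) : Prop := ρ.PosSemidef ∧ ρ.trace = 1

/-- The square root of a positive semidefinite matrix (functional calculus). -/
def matSqrt (P : Matrix n n ℂ) : Matrix n n ℂ := cfc Real.sqrt P

/-- The base-two logarithm of a positive semidefinite matrix (functional calculus); the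
logarithm vanishes on the kernel. -/
def matLog (ρ : Matrix n n ℂ) : Matrix n n ℂ := cfc (Real.logb 2) ρ

/-- Von Neumann entropy `-Tr (ρ log₂ ρ)`. -/
def vnEntropy (ρ : Matrix n n ℂ) : ℝ := -(ρ * matLog ρ).trace.re

open Classical in
/-- Quantum relative entropy `Tr (ρ log₂ ρ) - Tr (ρ log₂ σ)` of positive semidefinite, possibly
subnormalized, operators; it is `+∞` unless the support of `ρ` lies in that of `σ`, that is,
unless the kernel of `σ` lies in that of `ρ`. -/
def relEntropy (ρ σ : Matrix n n ℂ) : EReal :=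
  if ∀ v : n → ℂ, σ.mulVec v = 0 → ρ.mulVec v = 0 then
    (((ρ * matLog ρ).trace.re - (ρ * matLog σ).trace.re : ℝ) : EReal)
  else ⊤

variable [Fintype k] [DecidableEq k] [Fintype m] [DecidableEq m]

/-- `Z_j ⊗ 1`, the projector `|j⟩⟨j|` acting on the first register. -/
def keyProj (n : Type*) [DecidableEq n] (j : k) : Matrix (k × n) (k × n) ℂ :=
  proj j ⊗ₖ (1 : Matrix n n ℂ)

/-- The pinching `𝒵(σ) = ∑ j, Z_j σ Z_j` in the basis of the first register. -/
def pinch (σ : Matrix (k × n) (k × n) ℂ) : Matrix (k × n) (k × n) ℂ :=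
  ∑ j : k, keyProj n j * σ * keyProj n j

/-- The classical-quantum state `∑ j, |j⟩⟨j|_Z ⊗ Tr_{R…} [(Z_j ⊗ 1) ρ (Z_j ⊗ 1)]` of the outcome `Z`
of the measurement of the first register `R` (indexed by `k`) and of Eve's register (indexed
by `m`), the registers indexed by `n` being discarded together with `R`. -/
def measuredState (ρ : Matrix ((k × n) × m) ((k × n) × m) ℂ) : Matrix (k × m) (k × m) ℂ :=
  ∑ j : k, proj j ⊗ₖ
    traceLeft ((keyProj n j ⊗ₖ (1 : Matrix m m ℂ)) * ρ * (keyProj n j ⊗ₖ (1 : Matrix m m ℂ)))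

/-- Conditional von Neumann entropy `H(Z|E) = H(ZE) - H(E)`, `Z` being the outcome of the
measurement of the first register in its basis. -/
def condEntropy (ρ : Matrix ((k × n) × m) ((k × n) × m) ℂ) : ℝ :=
  vnEntropy (measuredState ρ) - vnEntropy (traceLeft ρ)

end LinearAlgebra

/-- A POVM with outcomes in `X` on the register indexed by `A`. -/
structure POVM (X A : Type*) [Fintype X] [Fintype A] [DecidableEq A] where
  /-- the effects -/
  effect : X → Matrix A A ℂ
  posSemidef : ∀ x, (effect x).PosSemidef
  sum_effect : ∑ x, effect x = 1

/-- The data of one round: measurements, announcements, sifting and (reverse-reconciliation)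
key map. The map `annA` sends an outcome to its announcement, so that the block `𝒳_a` of the
partition is the fibre over `a`; likewise for Bob. -/
structure Round (A B SA SB X Y : Type*) [Fintype A] [Fintype B] [DecidableEq A] [DecidableEq B]
    [Fintype X] [Fintype Y] where
  /-- Alice's POVM -/
  povmA : POVM X A
  /-- Bob's POVM -/
  povmB : POVM Y B
  /-- announcement attached to an outcome of Alice -/
  annA : X → SA
  /-- announcement attached to an outcome of Bob -/
  annB : Y → SB
  /-- common size of the blocks `𝒳_a` -/
  ωA : ℕ
  /-- common size of the blocks `𝒴_b` -/
  ωB : ℕ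
  /-- the bijections `f_a : Ω^A → 𝒳_a` -/
  fA : ∀ a : SA, Fin ωA ≃ {x : X // annA x = a}
  /-- the bijections `f_b : Ω^B → 𝒴_b` -/
  fB : ∀ b : SB, Fin ωB ≃ {y : Y // annB y = b}
  /-- the set `𝐊` of kept announcements; its complement `𝐃` is discarded -/
  kept : Finset (SA × SB)
  /-- number of key symbols -/
  N : ℕ
  /-- the key map `g(a, b, y)`, `y ∈ 𝒴_b` -/
  g : SA → (b : SB) → {y : Y // annB y = b} → Fin N

namespace Round

variable {A B E SA SB X Y : Type*} [Fintype A] [Fintype B] [Fintype E] [Fintype SA] [Fintype SB]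
  [Fintype X] [Fintype Y] [DecidableEq A] [DecidableEq B] [DecidableEq E] [DecidableEq SA]
  [DecidableEq SB] (M : Round A B SA SB X Y)

/-- `[A]`: the registers `A`, `Ã` (announcement), `Ā` (outcome). -/
abbrev RegA : Type _ := (A × SA) × Fin M.ωA

/-- `[B]`: the registers `B`, `B̃`, `B̄`. -/
abbrev RegB : Type _ := (B × SB) × Fin M.ωB

/-- `[A][B]`. -/
abbrev RegAB : Type _ := M.RegA × M.RegB

/-- The key register `R` with basis `0, …, N - 1, ⊥`; here `none` is `⊥`. -/
abbrev RegR : Type := Option (Fin M.N)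

/-- The sifting register `S` (and Eve's copy `E_S`): `true` is "keep", `false` is "discard". -/
abbrev RegS : Type := Bool

instance : DecidableEq M.RegA := instDecidableEqProd

instance : DecidableEq M.RegB := instDecidableEqProd

instance : DecidableEq M.RegAB := instDecidableEqProd

instance : DecidableEq (M.RegAB × RegS) := instDecidableEqProd

instance : DecidableEq (M.RegR × M.RegAB) := instDecidableEqProd

instance : DecidableEq (M.RegR × (M.RegAB × RegS)) := instDecidableEqProd

/-- Eve's registers `E`, `E_Ã`, `E_B̃` after the announcements. -/
abbrev RegE₁ (_M : Round A B SA SB X Y) (E : Type*) : Type _ := (E × SA) × SB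

/-- `[E]`: Eve's registers `E`, `E_Ã`, `E_B̃`, `E_S` after sifting. -/
abbrev RegE (E : Type*) : Type _ := M.RegE₁ E × RegS

/-- `K_a^A = ∑ α, √P^A_{[a, f_a(α)]} ⊗ |a⟩_Ã ⊗ |α⟩_Ā`. -/
def krausA (a : SA) : Matrix M.RegA A ℂ :=
  ∑ α, tensorKet (tensorKet (matSqrt (M.povmA.effect (M.fA a α))) (ket a)) (ket α)

/-- `K_b^B = ∑ β, √P^B_{[b, f_b(β)]} ⊗ |b⟩_B̃ ⊗ |β⟩_B̄`. -/
def krausB (b : SB) : Matrix M.RegB B ℂ :=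
  ∑ β, tensorKet (tensorKet (matSqrt (M.povmB.effect (M.fB b β))) (ket b)) (ket β)

/-- `W_A = ∑ a, K_a^A ⊗ |a⟩_{E_Ã}`. -/
def WA : Matrix (M.RegA × SA) A ℂ := ∑ a, tensorKet (M.krausA a) (ket a)

/-- `W_B = ∑ b, K_b^B ⊗ |b⟩_{E_B̃}`. -/
def WB : Matrix (M.RegB × SB) B ℂ := ∑ b, tensorKet (M.krausB b) (ket b)

/-- `Π = ∑_{(a,b) ∈ 𝐊} |a⟩⟨a|_Ã ⊗ |b⟩⟨b|_B̃`, as an operator on `[A][B]`. -/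
def siftProj : Matrix M.RegAB M.RegAB ℂ :=
  ∑ ab ∈ M.kept,
    (((1 : Matrix A A ℂ) ⊗ₖ proj ab.1) ⊗ₖ (1 : Matrix (Fin M.ωA) (Fin M.ωA) ℂ)) ⊗ₖ
    (((1 : Matrix B B ℂ) ⊗ₖ proj ab.2) ⊗ₖ (1 : Matrix (Fin M.ωB) (Fin M.ωB) ℂ))

/-- `V_S = Π ⊗ |𝐊⟩_S ⊗ |𝐊⟩_{E_S} + (1 - Π) ⊗ |𝐃⟩_S ⊗ |𝐃⟩_{E_S}`. -/
def VS : Matrix ((M.RegAB × RegS) × RegS) M.RegAB ℂ :=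
  tensorKet (tensorKet M.siftProj (ket true)) (ket true) +
    tensorKet (tensorKet (1 - M.siftProj) (ket false)) (ket false)

/-- `V = ∑_{(a,b) ∈ 𝐊, β} |g(a, b, f_b(β))⟩_R ⊗ |a⟩⟨a|_Ã ⊗ |b⟩⟨b|_B̃ ⊗ |β⟩⟨β|_B̄`. -/
def V : Matrix (M.RegR × M.RegAB) M.RegAB ℂ :=
  ∑ ab ∈ M.kept, ∑ β : Fin M.ωB,
    ketTensor (ket (some (M.g ab.1 ab.2 (M.fB ab.2 β))))
      ((((1 : Matrix A A ℂ) ⊗ₖ proj ab.1) ⊗ₖ (1 : Matrix (Fin M.ωA) (Fin M.ωA) ℂ)) ⊗ₖ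
        (((1 : Matrix B B ℂ) ⊗ₖ proj ab.2) ⊗ₖ proj β))

/-- `V_K = V Π + |⊥⟩_R ⊗ (1 - Π)`. -/
def VK : Matrix (M.RegR × M.RegAB) M.RegAB ℂ :=
  M.V * M.siftProj + ketTensor (ket none) (1 - M.siftProj)

/-! The three steps as operators on all registers, with the identity on the registers that are
not touched; `submatrix` only reorders the registers of the output. -/

/-- `W_A ⊗ W_B ⊗ 1_E`. -/
def annStep (E : Type*) [DecidableEq E] : Matrix (M.RegAB × M.RegE₁ E) ((A × B) × E) ℂ :=
  ((M.WA ⊗ₖ M.WB) ⊗ₖ (1 : Matrix E E ℂ)).submatrix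
    (fun p => (((p.1.1, p.2.1.2), (p.1.2, p.2.2)), p.2.1.1)) id

/-- `V_S ⊗ 1`. -/
def siftStep (E : Type*) [DecidableEq E] :
    Matrix ((M.RegAB × RegS) × M.RegE E) (M.RegAB × M.RegE₁ E) ℂ :=
  (M.VS ⊗ₖ (1 : Matrix (M.RegE₁ E) (M.RegE₁ E) ℂ)).submatrix
    (fun p => ((p.1, p.2.2), p.2.1)) id

/-- `V_K ⊗ 1`. -/
def keyStep (E : Type*) [DecidableEq E] :
    Matrix ((M.RegR × (M.RegAB × RegS)) × M.RegE E) ((M.RegAB × RegS) × M.RegE E) ℂ :=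
  ((M.VK ⊗ₖ (1 : Matrix RegS RegS ℂ)) ⊗ₖ (1 : Matrix (M.RegE E) (M.RegE E) ℂ)).submatrix
    (fun p => (((p.1.1, p.1.2.1), p.1.2.2), p.2)) id

/-- The state after measurement and announcement. -/
def rho1 (ρ : Matrix ((A × B) × E) ((A × B) × E) ℂ) :
    Matrix (M.RegAB × M.RegE₁ E) (M.RegAB × M.RegE₁ E) ℂ :=
  M.annStep E * ρ * (M.annStep E).conjTranspose

/-- The state after sifting. -/
def rho2 (ρ : Matrix ((A × B) × E) ((A × B) × E) ℂ) :
    Matrix ((M.RegAB × RegS) × M.RegE E) ((M.RegAB × RegS) × M.RegE E) ℂ :=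
  M.siftStep E * M.rho1 ρ * (M.siftStep E).conjTranspose

/-- The final state `ρ⁽³⁾_{R[A][B]S[E]}` after the key map. -/
def rho3 (ρ : Matrix ((A × B) × E) ((A × B) × E) ℂ) :
    Matrix ((M.RegR × (M.RegAB × RegS)) × M.RegE E)
      ((M.RegR × (M.RegAB × RegS)) × M.RegE E) ℂ :=
  M.keyStep E * M.rho2 ρ * (M.keyStep E).conjTranspose

/-- `ρ⁽³⁾_{R[A][B]S} = Tr_{[E]} ρ⁽³⁾_{R[A][B]S[E]}`. -/
def rhoRABS (ρ : Matrix ((A × B) × E) ((A × B) × E) ℂ) :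
    Matrix (M.RegR × (M.RegAB × RegS)) (M.RegR × (M.RegAB × RegS)) ℂ :=
  traceRight (M.rho3 ρ)

/-- Announcement map `𝒜(σ) = ∑_{a,b} (K_a^A ⊗ K_b^B) σ (K_a^A ⊗ K_b^B)†`. -/
def annMap (σ : Matrix (A × B) (A × B) ℂ) : Matrix M.RegAB M.RegAB ℂ :=
  ∑ a, ∑ b, (M.krausA a ⊗ₖ M.krausB b) * σ * (M.krausA a ⊗ₖ M.krausB b).conjTranspose

/-- `𝒢(σ) = V Π 𝒜(σ) Π V†`. -/
def G (σ : Matrix (A × B) (A × B) ℂ) : Matrix (M.RegR × M.RegAB) (M.RegR × M.RegAB) ℂ :=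
  M.V * M.siftProj * M.annMap σ * M.siftProj * M.V.conjTranspose

/-- Sifting probability `p_pass = Tr (𝒜(σ) Π)`. -/
def pPass (σ : Matrix (A × B) (A × B) ℂ) : ℝ := (M.annMap σ * M.siftProj).trace.re

/-- The state on `R[A][B]` conditioned on keeping the round (the zero matrix if `p_pass = 0`). -/
def rhoK (σ : Matrix (A × B) (A × B) ℂ) : Matrix (M.RegR × M.RegAB) (M.RegR × M.RegAB) ℂ :=
  ((M.pPass σ : ℂ))⁻¹ • M.G σ

/-- The state on `R[A][B]` conditioned on discarding the round, with key symbol `⊥`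
(the zero matrix if `p_pass = 1`). -/
def rhoD (σ : Matrix (A × B) (A × B) ℂ) : Matrix (M.RegR × M.RegAB) (M.RegR × M.RegAB) ℂ :=
  (((1 - M.pPass σ : ℝ) : ℂ))⁻¹ •
    (proj (none : M.RegR) ⊗ₖ ((1 - M.siftProj) * M.annMap σ * (1 - M.siftProj)))

/-- `τ ⊗ |s⟩⟨s|_S`, with the registers in the order `R`, `[A][B]`, `S`. -/
def withS (τ : Matrix (M.RegR × M.RegAB) (M.RegR × M.RegAB) ℂ) (s : RegS) :
    Matrix (M.RegR × (M.RegAB × RegS)) (M.RegR × (M.RegAB × RegS)) ℂ :=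
  (τ ⊗ₖ proj s).submatrix (fun p => ((p.1, p.2.1), p.2.2)) (fun p => ((p.1, p.2.1), p.2.2))

/-- The pinching with the symbol `⊥` removed: `∑_{j < N} Z_j τ Z_j`. -/
def pinchKey (τ : Matrix (M.RegR × M.RegAB) (M.RegR × M.RegAB) ℂ) :
    Matrix (M.RegR × M.RegAB) (M.RegR × M.RegAB) ℂ :=
  ∑ j : Fin M.N, keyProj M.RegAB (some j : M.RegR) * τ * keyProj M.RegAB (some j : M.RegR)

end Round

end QKD

end

/-!
The proof rests on two facts.

*Duality for pure states.* Let `Φ` be a pure state on `R`, other registers `n` and Eve's register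
`m`, and let `C` be its matrix of amplitudes with rows `R n` and columns `m`. The state without Eve
is `C Cᴴ`, and Eve's state is `(Cᴴ C)ᵀ`; these have the same nonzero spectrum, hence the same
entropy (`vnEntropy_mul_conjTranspose`). If `D` arises from `C` by copying `R` coherently into
Eve's side, then `D Dᴴ` is the pinched state and `(Dᴴ D)ᵀ` is the joint state of the measurement
outcome and Eve. So the conditional entropy of the outcome is the entropy gain of `C Cᴴ` under
pinching. That gain is the relative entropy to the pinched state, because the logarithm of the
pinched state is block diagonal (`relEntropy_pinch`, `condEntropy_pureState`).

*Block structure of the final state.* Eve's registers hold copies of the announcements and of the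
sifting decision. Tracing them out dephases these registers, and leaves the sum of the kept block
`𝒢(ρ) ⊗ |𝐊⟩⟨𝐊|` and a discarded block with key symbol `⊥` (`Round.rhoRABS_eq`). Pinching in `R` acts
in each block separately and does not change the discarded one. As entropy is additive over blocks,
only the kept block contributes (`Round.relEntropy_pinch_rhoRABS`). The normalized form follows from
homogeneity of the relative entropy of coherence (`relEntropy_pinch_smul`). When a block has
weight `0` it vanishes, being positive with trace `0`, so the convention for the quotient is
harmless.

Entropies are compared through characteristic polynomials, since the entropy of a Hermitian matrix
is a function of the roots of its characteristic polynomial (`vnEntropy_eq_sum_roots_charpoly`).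
-/

noncomputable section

namespace QKD

/-! ### Von Neumann entropy -/

section Entropy

variable {m n : Type*} [Fintype n] [DecidableEq n] [Fintype m] [DecidableEq m]

lemma continuousOn_spectrum_real (ρ : Matrix n n ℂ) (f : ℝ → ℝ) :
    ContinuousOn f (spectrum ℝ ρ) :=
  ρ.finite_real_spectrum.continuousOn f

/-- The product `ρ log₂ ρ` as a single functional calculus. -/
lemma mul_matLog {ρ : Matrix n n ℂ} (hρ : ρ.IsHermitian) :
    ρ * matLog ρ = cfc (fun x => x * Real.logb 2 x) ρ := by
  have hρ' : IsSelfAdjoint ρ := hρ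
  rw [cfc_mul (fun x => x) (Real.logb 2) ρ (continuousOn_spectrum_real _ _)
    (continuousOn_spectrum_real _ _), cfc_id' ℝ ρ]
  rfl

/-- The entropy depends only on the multiset of roots of the characteristic polynomial, so
that identities between characteristic polynomials become identities between entropies. -/
lemma vnEntropy_eq_sum_roots_charpoly {ρ : Matrix n n ℂ} (hρ : ρ.IsHermitian) :
    vnEntropy ρ = -(ρ.charpoly.roots.map fun z => z.re * Real.logb 2 z.re).sum := by
  have htr : (ρ * matLog ρ).trace.re =
      ∑ i, hρ.eigenvalues i * Real.logb 2 (hρ.eigenvalues i) := by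
    rw [mul_matLog hρ, hρ.cfc_eq, Matrix.IsHermitian.cfc, Unitary.conjStarAlgAut_apply,
      Matrix.trace_mul_comm, ← mul_assoc]
    simp [Matrix.trace, Matrix.diagonal]
  rw [vnEntropy, htr, hρ.roots_charpoly_eq_eigenvalues]
  simp

lemma vnEntropy_transpose {ρ : Matrix n n ℂ} (hρ : ρ.IsHermitian) :
    vnEntropy ρ.transpose = vnEntropy ρ := by
  rw [vnEntropy_eq_sum_roots_charpoly hρ.transpose, vnEntropy_eq_sum_roots_charpoly hρ,
    Matrix.charpoly_transpose]

/-- The two marginals of a pure state have the same entropy: `C Cᴴ` and `Cᴴ C` have the same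
nonzero spectrum. -/
lemma vnEntropy_mul_conjTranspose (C : Matrix m n ℂ) :
    vnEntropy (C * C.conjTranspose) = vnEntropy (C.conjTranspose * C) := by
  rw [vnEntropy_eq_sum_roots_charpoly (Matrix.isHermitian_mul_conjTranspose_self C),
    vnEntropy_eq_sum_roots_charpoly (Matrix.isHermitian_conjTranspose_mul_self C)]
  have h := congrArg
    (fun p : Polynomial ℂ => (p.roots.map fun z => z.re * Real.logb 2 z.re).sum)
    (Matrix.charpoly_mul_comm' C C.conjTranspose)
  have hm := mul_ne_zero (pow_ne_zero (Fintype.card n) Polynomial.X_ne_zero)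
    (C * C.conjTranspose).charpoly_monic.ne_zero
  have hn := mul_ne_zero (pow_ne_zero (Fintype.card m) Polynomial.X_ne_zero)
    (C.conjTranspose * C).charpoly_monic.ne_zero
  simp only [Polynomial.roots_mul hm, Polynomial.roots_mul hn, Polynomial.roots_X_pow,
    Multiset.map_add, Multiset.sum_add, Multiset.map_nsmul, Multiset.sum_nsmul,
    Multiset.map_singleton, Multiset.sum_singleton, Complex.zero_re, zero_mul, smul_zero, zero_add] at h
  rw [h]

/-- Entropy is additive on block-diagonal operators, here with the block label on the right. -/
lemma vnEntropy_kronecker_proj_add {ρ σ : Matrix n n ℂ} (hρ : ρ.IsHermitian)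
    (hσ : σ.IsHermitian) {e : m ≃ n × Bool} :
    vnEntropy ((ρ ⊗ₖ proj true + σ ⊗ₖ proj false).submatrix e e) =
      vnEntropy ρ + vnEntropy σ := by
  have hblock : (ρ ⊗ₖ proj true + σ ⊗ₖ proj false : Matrix (n × Bool) (n × Bool) ℂ) =
      Matrix.reindex ((Equiv.boolProdEquivSum n).symm.trans (Equiv.prodComm _ _))
        ((Equiv.boolProdEquivSum n).symm.trans (Equiv.prodComm _ _))
        (Matrix.fromBlocks σ 0 0 ρ) := by
    ext ⟨i, s⟩ ⟨j, t⟩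
    cases s <;> cases t <;> simp [proj, Equiv.boolProdEquivSum, Matrix.single]
  have hherm : ((Matrix.reindex ((Equiv.boolProdEquivSum n).symm.trans (Equiv.prodComm _ _))
      ((Equiv.boolProdEquivSum n).symm.trans (Equiv.prodComm _ _))
        (Matrix.fromBlocks σ 0 0 ρ)).submatrix e e).IsHermitian :=
    ((hσ.fromBlocks (by simp) hρ).submatrix _).submatrix _
  rw [vnEntropy_eq_sum_roots_charpoly hρ, vnEntropy_eq_sum_roots_charpoly hσ, hblock,
    vnEntropy_eq_sum_roots_charpoly hherm,
    show ∀ N : Matrix (n × Bool) (n × Bool) ℂ, N.submatrix e e = Matrix.reindex e.symm e.symm N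
      from fun _ => rfl, Matrix.charpoly_reindex, Matrix.charpoly_reindex,
    Matrix.charpoly_fromBlocks_zero₁₂, Polynomial.roots_mul
      (mul_ne_zero σ.charpoly_monic.ne_zero ρ.charpoly_monic.ne_zero), Multiset.map_add,
    Multiset.sum_add]
  ring

lemma vnEntropy_smul {ρ : Matrix n n ℂ} (hρ : ρ.IsHermitian) (c : ℝ) :
    vnEntropy ((c : ℂ) • ρ) = c * vnEntropy ρ - c * Real.logb 2 c * ρ.trace.re := by
  have hρ' : IsSelfAdjoint ρ := hρ
  rcases eq_or_ne c 0 with rfl | hc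
  · simp [vnEntropy]
  have hsm : (c : ℂ) • ρ = c • ρ := by ext; simp
  have hcρ : (c • ρ).IsHermitian := IsSelfAdjoint.smul (IsSelfAdjoint.all c) hρ'
  -- For `x = 0` both sides vanish, by the convention `logb 2 0 = 0`.
  have hη : (fun x : ℝ => c * x * Real.logb 2 (c * x)) =
      fun x => c * (x * Real.logb 2 x) + c * Real.logb 2 c * x := by
    funext x
    rcases eq_or_ne x 0 with rfl | hx
    · simp
    · rw [Real.logb_mul hc hx]; ring
  have key : c • ρ * matLog (c • ρ) =
      c • (ρ * matLog ρ) + (c * Real.logb 2 c) • ρ := by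
    rw [mul_matLog hcρ, mul_matLog hρ,
      ← cfc_comp_const_mul c (fun x => x * Real.logb 2 x) ρ
        ((ρ.finite_real_spectrum.image _).continuousOn _), hη,
      cfc_add (fun x => c * (x * Real.logb 2 x)) (fun x => c * Real.logb 2 c * x) (a := ρ)
        (continuousOn_spectrum_real _ _) (continuousOn_spectrum_real _ _),
      cfc_const_mul c _ ρ (continuousOn_spectrum_real _ _),
      cfc_const_mul_id (c * Real.logb 2 c) ρ]
  rw [hsm, vnEntropy, key, vnEntropy]
  simp only [Matrix.trace_add, Matrix.trace_smul, Complex.add_re, Complex.real_smul,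
    Complex.re_ofReal_mul]
  ring

end Entropy

/-! ### Pinching and the relative entropy of coherence -/

section Pinching

variable {k m n : Type*} [DecidableEq n] [DecidableEq k]

lemma keyProj_eq_diagonal (j : k) :
    keyProj n j = Matrix.diagonal fun p : k × n => if p.1 = j then (1 : ℂ) else 0 := by
  ext ⟨r, x⟩ ⟨s, y⟩
  simp only [keyProj, proj, Matrix.kroneckerMap_apply, Matrix.single_apply, Matrix.one_apply,
    Matrix.diagonal_apply, Prod.mk.injEq]
  grind

lemma keyProj_isHermitian (j : k) : (keyProj n j).IsHermitian := by
  rw [keyProj_eq_diagonal]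
  refine Matrix.isHermitian_diagonal_of_self_adjoint _ ?_
  ext p
  simp only [Pi.star_apply]
  split_ifs <;> simp

variable [Fintype k]

lemma sum_keyProj : ∑ j : k, keyProj n j = 1 := by
  simp_rw [keyProj_eq_diagonal]
  ext p q
  simp only [Matrix.sum_apply, Matrix.diagonal_apply, Matrix.one_apply]
  split_ifs <;> simp

variable [Fintype n]

lemma keyProj_mul_keyProj (i j : k) :
    keyProj n i * keyProj n j = if i = j then keyProj n i else 0 := by
  simp only [keyProj_eq_diagonal, Matrix.diagonal_mul_diagonal]
  split_ifs with h
  · subst h; congr 1; funext p; simp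
  · rw [← Matrix.diagonal_zero]; congr 1; funext p; grind

/-- Pinching deletes the matrix entries between different values of the first register. -/
lemma pinch_apply (σ : Matrix (k × n) (k × n) ℂ) (p q : k × n) :
    pinch σ p q = if p.1 = q.1 then σ p q else 0 := by
  simp only [pinch, keyProj_eq_diagonal, Matrix.sum_apply, Matrix.mul_diagonal,
    Matrix.diagonal_mul, ite_mul, one_mul, zero_mul, mul_ite, mul_one, mul_zero]
  rw [Finset.sum_eq_single q.1]
  · simp
  · intro j _ hj; simp [Ne.symm hj]
  · simp

lemma pinch_smul (c : ℂ) (σ : Matrix (k × n) (k × n) ℂ) : pinch (c • σ) = c • pinch σ := by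
  ext p q; simp [pinch_apply]

lemma trace_pinch (σ : Matrix (k × n) (k × n) ℂ) : (pinch σ).trace = σ.trace := by
  simp [Matrix.trace, pinch_apply]

lemma posSemidef_keyProj_conj {τ : Matrix (k × n) (k × n) ℂ} (hτ : τ.PosSemidef) (j : k) :
    (keyProj n j * τ * keyProj n j).PosSemidef := by
  simpa only [(keyProj_isHermitian j).eq] using hτ.mul_mul_conjTranspose_same (keyProj n j)

lemma posSemidef_pinch {τ : Matrix (k × n) (k × n) ℂ} (hτ : τ.PosSemidef) :
    (pinch τ).PosSemidef :=
  Matrix.posSemidef_sum _ fun j _ => posSemidef_keyProj_conj hτ j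

lemma commute_pinch_keyProj (τ : Matrix (k × n) (k × n) ℂ) (j : k) :
    Commute (pinch τ) (keyProj n j) := by
  ext p q
  simp only [keyProj_eq_diagonal, Matrix.mul_diagonal, Matrix.diagonal_mul, pinch_apply]
  grind

/-- The support condition in the relative entropy to the pinched operator. If the expectation of
`pinch τ` in `v` vanishes, so do its summands, the expectations of `τ` in `Z_j v`; hence `τ` kills
every `Z_j v`, and so their sum `v`. -/
lemma mulVec_eq_zero_of_pinch_mulVec_eq_zero {τ : Matrix (k × n) (k × n) ℂ}
    (hτ : τ.PosSemidef) {v : k × n → ℂ} (hv : (pinch τ).mulVec v = 0) : τ.mulVec v = 0 := by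
  have hpos (j : k) : 0 ≤ star v ⬝ᵥ (keyProj n j * τ * keyProj n j).mulVec v :=
    (posSemidef_keyProj_conj hτ j).dotProduct_mulVec_nonneg v
  have hsum : ∑ j : k, star v ⬝ᵥ (keyProj n j * τ * keyProj n j).mulVec v = 0 := by
    rw [← dotProduct_sum, ← Matrix.sum_mulVec]
    change star v ⬝ᵥ (pinch τ).mulVec v = 0
    rw [hv, dotProduct_zero]
  have hj (j : k) : τ.mulVec ((keyProj n j).mulVec v) = 0 := by
    have h0 := (Finset.sum_eq_zero_iff_of_nonneg fun j _ => hpos j).1 hsum j (Finset.mem_univ j)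
    rw [← hτ.dotProduct_mulVec_zero_iff, ← h0, Matrix.star_mulVec, (keyProj_isHermitian j).eq,
      ← Matrix.dotProduct_mulVec, Matrix.mulVec_mulVec, Matrix.mulVec_mulVec, mul_assoc]
  calc τ.mulVec v = τ.mulVec ((∑ j : k, keyProj n j).mulVec v) := by
        rw [sum_keyProj, Matrix.one_mulVec]
    _ = 0 := by
        rw [Matrix.sum_mulVec, Matrix.mulVec_sum]
        exact Finset.sum_eq_zero fun j _ => hj j

/-- The relative entropy of coherence is the entropy gain under pinching. The reason is that
`log (pinch τ)` is block diagonal, so that its expectations in `τ` and in `pinch τ` agree. -/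
lemma relEntropy_pinch {τ : Matrix (k × n) (k × n) ℂ} (hτ : τ.PosSemidef) :
    relEntropy τ (pinch τ) = ((vnEntropy (pinch τ) - vnEntropy τ : ℝ) : EReal) := by
  have hcomm (j : k) : Commute (matLog (pinch τ)) (keyProj n j) :=
    (commute_pinch_keyProj τ j).cfc_real _
  have htr : (pinch τ * matLog (pinch τ)).trace = (τ * matLog (pinch τ)).trace := by
    calc (pinch τ * matLog (pinch τ)).trace
        = ∑ j : k, (keyProj n j * τ * keyProj n j * matLog (pinch τ)).trace := by
          rw [← Matrix.trace_sum, ← Finset.sum_mul]; rfl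
      _ = ∑ j : k, (τ * matLog (pinch τ) * keyProj n j).trace := by
          refine Finset.sum_congr rfl fun j _ => ?_
          rw [mul_assoc, mul_assoc, Matrix.trace_mul_comm, mul_assoc, ← (hcomm j).eq,
            mul_assoc, mul_assoc, keyProj_mul_keyProj, if_pos rfl, ← mul_assoc]
      _ = (τ * matLog (pinch τ)).trace := by
          rw [← Matrix.trace_sum, ← Finset.mul_sum, sum_keyProj, mul_one]
  rw [relEntropy, if_pos fun v hv => mulVec_eq_zero_of_pinch_mulVec_eq_zero hτ hv, ← htr]
  congr 1
  simp only [vnEntropy]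
  ring

lemma relEntropy_self (ρ : Matrix n n ℂ) : relEntropy ρ ρ = 0 := by
  simp [relEntropy]

/-- Relative entropy of coherence is homogeneous of degree one: the terms `c log c` of the two
entropies cancel because pinching preserves the trace. -/
lemma relEntropy_pinch_smul {τ : Matrix (k × n) (k × n) ℂ} (hτ : τ.PosSemidef) {c : ℝ}
    (hc : 0 ≤ c) :
    relEntropy ((c : ℂ) • τ) (pinch ((c : ℂ) • τ)) = (c : EReal) * relEntropy τ (pinch τ) := by
  rw [relEntropy_pinch hτ, relEntropy_pinch (hτ.smul (by exact_mod_cast hc)), pinch_smul,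
    vnEntropy_smul hτ.isHermitian, vnEntropy_smul (posSemidef_pinch hτ).isHermitian,
    trace_pinch, ← EReal.coe_mul]
  congr 1
  ring

variable [Fintype m] [DecidableEq m]

lemma measuredState_apply (ρ : Matrix ((k × n) × m) ((k × n) × m) ℂ) (p q : k × m) :
    measuredState ρ p q =
      if p.1 = q.1 then ∑ x, ρ ((p.1, x), p.2) ((q.1, x), q.2) else 0 := by
  have hkey (l : k) : keyProj n l ⊗ₖ (1 : Matrix m m ℂ) =
      Matrix.diagonal fun p : (k × n) × m => if p.1.1 = l then (1 : ℂ) else 0 := by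
    rw [keyProj_eq_diagonal, ← Matrix.diagonal_one, Matrix.diagonal_kronecker_diagonal]
    simp
  obtain ⟨i, e⟩ := p
  obtain ⟨j, f⟩ := q
  simp only [measuredState, hkey, traceLeft, Matrix.sum_apply, Matrix.kroneckerMap_apply, proj,
    Matrix.single_apply, Matrix.of_apply, Matrix.mul_diagonal, Matrix.diagonal_mul,
    Fintype.sum_prod_type]
  rw [Finset.sum_eq_single i]
  · by_cases hij : i = j
    · subst hij
      simp only [and_self, if_true, one_mul, ite_mul, zero_mul, mul_ite, mul_one, mul_zero]
      rw [Finset.sum_eq_single i]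
      · simp
      · intro a _ ha; simp [ha]
      · simp
    · simp [hij]
  · intro l _ hl; simp [hl]
  · simp

/-- For a pure state, the entropy of the outcome of a measurement of the first register,
conditioned on the purifying register, is the relative entropy of coherence of the reduced
state. With `C` the matrix of amplitudes, the reduced state is `C Cᴴ` and the purifying marginal
is `(Cᴴ C)ᵀ`; the pinched state and the measured state arise in the same way from the matrix `D`
obtained from `C` by copying the first register. -/
theorem condEntropy_pureState (Φ : (k × n) × m → ℂ) :
    ((condEntropy (pureState Φ) : ℝ) : EReal) =
      relEntropy (traceRight (pureState Φ)) (pinch (traceRight (pureState Φ))) := by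
  let C : Matrix (k × n) m ℂ := Matrix.of fun p e => Φ (p, e)
  let D : Matrix (k × n) (k × m) ℂ := Matrix.of fun p e => if p.1 = e.1 then Φ (p, e.2) else 0
  have hR : traceRight (pureState Φ) = C * C.conjTranspose := by
    ext p q
    simp [traceRight, pureState, Matrix.vecMulVec_apply, Matrix.mul_apply, C]
  have hE : traceLeft (pureState Φ) = (C.conjTranspose * C).transpose := by
    ext e f
    simp [traceLeft, pureState, Matrix.vecMulVec_apply, Matrix.mul_apply, C, mul_comm]
  have hP : pinch (traceRight (pureState Φ)) = D * D.conjTranspose := by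
    ext p q
    rw [pinch_apply]
    simp only [traceRight, pureState, Matrix.of_apply, Matrix.vecMulVec_apply, Matrix.mul_apply,
      D, Matrix.conjTranspose_apply, Fintype.sum_prod_type, Pi.star_apply]
    rw [Finset.sum_eq_single p.1]
    · split_ifs with h h' h' <;> simp_all
    · intro j _ hj; simp [Ne.symm hj]
    · simp
  have hM : measuredState (pureState Φ) = (D.conjTranspose * D).transpose := by
    ext p q
    rw [measuredState_apply]
    simp only [pureState, Matrix.vecMulVec_apply, Matrix.transpose_apply, Matrix.mul_apply, D,
      Matrix.conjTranspose_apply, Fintype.sum_prod_type, Pi.star_apply, Matrix.of_apply]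
    rw [Finset.sum_eq_single p.1]
    · split_ifs with h <;> simp_all [mul_comm]
    · intro j _ hj; simp [hj]
    · simp
  have hτ : (traceRight (pureState Φ)).PosSemidef := by
    rw [hR]; exact Matrix.posSemidef_self_mul_conjTranspose C
  rw [relEntropy_pinch hτ, hP, hR, vnEntropy_mul_conjTranspose, vnEntropy_mul_conjTranspose,
    condEntropy, hM, hE, vnEntropy_transpose (Matrix.isHermitian_conjTranspose_mul_self C),
    vnEntropy_transpose (Matrix.isHermitian_conjTranspose_mul_self D)]

end Pinching

/-! ### Operators on composite registers -/

section Registers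

variable {k l m n : Type*}

/-- The operator `1 ⊗ ⟨e|`, which contracts the right-hand register with `|e⟩`. -/
def braRight (n : Type*) [DecidableEq m] [DecidableEq n] (e : m) : Matrix n (n × m) ℂ :=
  Matrix.of fun x p => if p = (x, e) then 1 else 0

lemma mul_pureState_mul_conjTranspose [Fintype n] (L : Matrix m n ℂ) (ψ : n → ℂ) :
    L * pureState ψ * L.conjTranspose = pureState (L.mulVec ψ) := by
  rw [pureState, Matrix.mul_vecMulVec, Matrix.vecMulVec_mul, pureState, Matrix.star_mulVec]

lemma posSemidef_pureState [Finite n] (ψ : n → ℂ) : (pureState ψ).PosSemidef :=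
  Matrix.posSemidef_vecMulVec_self_star ψ

lemma traceRight_eq_sum_braRight [Fintype m] [Fintype n] [DecidableEq m] [DecidableEq n]
    (ρ : Matrix (n × m) (n × m) ℂ) :
    traceRight ρ = ∑ e : m, braRight n e * ρ * (braRight n e).conjTranspose := by
  ext x y
  simp [traceRight, braRight, Matrix.sum_apply, Matrix.mul_apply]

lemma braRight_mul_apply [Fintype m] [Fintype n] [DecidableEq m] [DecidableEq n] (e : m)
    (L : Matrix (n × m) l ℂ) (x : n) (j : l) : (braRight n e * L) x j = L (x, e) j := by
  simp [braRight, Matrix.mul_apply]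

lemma mul_braRight_apply [Fintype n] [DecidableEq m] [DecidableEq n] (e : m)
    (L : Matrix l n ℂ) (i : l) (p : n × m) :
    (L * braRight n e) i p = if p.2 = e then L i p.1 else 0 := by
  obtain ⟨y, e'⟩ := p
  by_cases h : e' = e <;> simp [braRight, Matrix.mul_apply, h]

lemma posSemidef_proj [Finite k] [DecidableEq k] (s : k) : (proj s).PosSemidef := by
  have h : proj s = pureState (ket s) := by
    ext i j
    simp only [proj, pureState, ket, Matrix.vecMulVec_apply, Matrix.single_apply, Pi.star_apply,
      Pi.single_apply]
    split_ifs <;> simp_all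
  rw [h]
  exact posSemidef_pureState _

lemma tensorKet_mul [Fintype n] (L : Matrix m n ℂ) (v : k → ℂ) (N : Matrix n l ℂ) :
    tensorKet L v * N = tensorKet (L * N) v := by
  ext p j
  simp only [tensorKet, Matrix.mul_apply, Matrix.of_apply, Finset.sum_mul]
  exact Finset.sum_congr rfl fun _ _ => by ring

lemma ketTensor_mul [Fintype n] (L : Matrix m n ℂ) (v : k → ℂ) (N : Matrix n l ℂ) :
    ketTensor v L * N = ketTensor v (L * N) := by
  ext p j
  simp only [ketTensor, Matrix.mul_apply, Matrix.of_apply, Finset.mul_sum]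
  exact Finset.sum_congr rfl fun _ _ => by ring

lemma tensorKet_mul_conjTranspose [DecidableEq k] [Fintype n] (L N : Matrix m n ℂ) (s : k) :
    tensorKet L (ket s) * (tensorKet N (ket s)).conjTranspose =
      (L * N.conjTranspose) ⊗ₖ proj s := by
  ext ⟨x, i⟩ ⟨y, j⟩
  simp only [tensorKet, ket, proj, Matrix.mul_apply, Matrix.of_apply,
    Matrix.conjTranspose_apply, Matrix.kroneckerMap_apply, Matrix.single_apply, Pi.single_apply]
  by_cases hi : i = s <;> by_cases hj : j = s <;> simp [hi, hj, Ne.symm]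

lemma ketTensor_mul_conjTranspose [DecidableEq k] [Fintype n] (L N : Matrix m n ℂ) (s : k) :
    ketTensor (ket s) L * (ketTensor (ket s) N).conjTranspose =
      proj s ⊗ₖ (L * N.conjTranspose) := by
  ext ⟨i, x⟩ ⟨j, y⟩
  simp only [ketTensor, ket, proj, Matrix.mul_apply, Matrix.of_apply,
    Matrix.conjTranspose_apply, Matrix.kroneckerMap_apply, Matrix.single_apply, Pi.single_apply]
  by_cases hi : i = s <;> by_cases hj : j = s <;> simp [hi, hj, Ne.symm]

end Registers

/-! ### Completeness of the Kraus operators -/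

section Measurement

variable {X A S : Type*} [Fintype X] [Fintype A] [DecidableEq A] [Fintype S] [DecidableEq S]

lemma matSqrt_isHermitian (P : Matrix A A ℂ) : (matSqrt P).IsHermitian :=
  cfc_predicate (R := ℝ) (p := IsSelfAdjoint) Real.sqrt P

lemma matSqrt_mul_self {P : Matrix A A ℂ} (hP : P.PosSemidef) : matSqrt P * matSqrt P = P := by
  have hP' : IsSelfAdjoint P := hP.isHermitian
  rw [matSqrt, ← cfc_mul Real.sqrt Real.sqrt P (continuousOn_spectrum_real _ _)
    (continuousOn_spectrum_real _ _)]
  conv_rhs => rw [← cfc_id' ℝ P]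
  refine cfc_congr fun x hx => ?_
  rw [hP.isHermitian.spectrum_real_eq_range_eigenvalues] at hx
  obtain ⟨i, rfl⟩ := hx
  exact Real.mul_self_sqrt (hP.eigenvalues_nonneg i)

/-- The Kraus operators of an announced measurement are complete, because each outcome belongs
to exactly one block of the partition. -/
lemma sum_conjTranspose_mul_kraus (P : POVM X A) (ann : X → S) {ω : ℕ}
    (f : ∀ a : S, Fin ω ≃ {x : X // ann x = a}) (K : S → Matrix ((A × S) × Fin ω) A ℂ)
    (hK : ∀ a, K a = ∑ α, tensorKet (tensorKet (matSqrt (P.effect (f a α))) (ket a)) (ket α)) :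
    ∑ a, (K a).conjTranspose * K a = 1 := by
  have hKa (a : S) : (K a).conjTranspose * K a = ∑ α, P.effect (f a α) := by
    have hentry (p : (A × S) × Fin ω) (j : A) :
        K a p j = if p.1.2 = a then matSqrt (P.effect (f a p.2)) p.1.1 j else 0 := by
      simp only [hK, tensorKet, ket, Matrix.sum_apply, Pi.single_apply, Matrix.of_apply]
      simp
    have hP : ∑ α, P.effect (f a α) =
        ∑ α, (matSqrt (P.effect (f a α))).conjTranspose * matSqrt (P.effect (f a α)) := by
      refine Finset.sum_congr rfl fun α _ => ?_
      rw [(matSqrt_isHermitian _).eq, matSqrt_mul_self (P.posSemidef _)]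
    rw [hP]
    ext i j
    simp only [Matrix.mul_apply, Matrix.conjTranspose_apply, hentry, Fintype.sum_prod_type,
      Matrix.sum_apply]
    rw [Finset.sum_comm, Finset.sum_eq_single a]
    · simp only [if_true]
      exact Finset.sum_comm
    · intro b _ hb; simp [hb]
    · simp
  rw [Finset.sum_congr rfl fun a _ => hKa a,
    Finset.sum_congr rfl fun a _ => Equiv.sum_comp (f a) fun x => P.effect x,
    Fintype.sum_fiberwise ann P.effect, P.sum_effect]

end Measurement

/-! ### Sifting projector, key isometry and announcement map -/

namespace Round

variable {A B E SA SB X Y : Type*} [Fintype A] [Fintype B] [Fintype X] [Fintype Y]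
  [DecidableEq A] [DecidableEq B] (M : Round A B SA SB X Y)

lemma withS_smul (c : ℂ) (τ : Matrix (M.RegR × M.RegAB) (M.RegR × M.RegAB) ℂ) (s : RegS) :
    M.withS (c • τ) s = c • M.withS τ s := by
  rw [withS, Matrix.smul_kronecker]
  rfl

variable [DecidableEq SA] [DecidableEq SB]

lemma siftProj_eq_diagonal :
    M.siftProj = Matrix.diagonal fun p : M.RegAB =>
      if (p.1.1.2, p.2.1.2) ∈ M.kept then (1 : ℂ) else 0 := by
  ext ⟨⟨⟨i, a⟩, α⟩, ⟨⟨j, b⟩, β⟩⟩ ⟨⟨⟨i', a'⟩, α'⟩, ⟨⟨j', b'⟩, β'⟩⟩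
  have hterm (ab : SA × SB) :
      ((((1 : Matrix A A ℂ) ⊗ₖ proj ab.1) ⊗ₖ (1 : Matrix (Fin M.ωA) (Fin M.ωA) ℂ)) ⊗ₖ
        (((1 : Matrix B B ℂ) ⊗ₖ proj ab.2) ⊗ₖ (1 : Matrix (Fin M.ωB) (Fin M.ωB) ℂ)))
        (((i, a), α), ((j, b), β)) (((i', a'), α'), ((j', b'), β')) =
      if ab = (a, b) then
        (if ((((i, a), α), ((j, b), β)) : M.RegAB) = (((i', a'), α'), ((j', b'), β'))
          then (1 : ℂ) else 0) else 0 := by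
    obtain ⟨c, d⟩ := ab
    simp only [Matrix.kroneckerMap_apply, proj, Matrix.single_apply, Matrix.one_apply,
      Prod.mk.injEq, ← ite_and, mul_ite, mul_one, mul_zero]
    exact if_congr (by grind) rfl rfl
  simp only [siftProj, Matrix.sum_apply, hterm, Finset.sum_ite_eq', Matrix.diagonal_apply]
  split_ifs <;> rfl

lemma siftProj_isHermitian : M.siftProj.IsHermitian := by
  rw [siftProj_eq_diagonal]
  refine Matrix.isHermitian_diagonal_of_self_adjoint _ ?_
  ext p
  simp only [Pi.star_apply]
  split_ifs <;> simp

lemma one_sub_siftProj_isHermitian : (1 - M.siftProj).IsHermitian :=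
  Matrix.isHermitian_one.sub M.siftProj_isHermitian

lemma V_apply (r : M.RegR) (p q : M.RegAB) :
    M.V (r, p) q = if (p.1.1.2, p.2.1.2) ∈ M.kept then
      (if p = q ∧ r = some (M.g p.1.1.2 p.2.1.2 (M.fB p.2.1.2 p.2.2)) then (1 : ℂ) else 0)
      else 0 := by
  obtain ⟨⟨⟨i, a⟩, α⟩, ⟨⟨j, b⟩, β⟩⟩ := p
  obtain ⟨⟨⟨i', a'⟩, α'⟩, ⟨⟨j', b'⟩, β'⟩⟩ := q
  have hterm (ab : SA × SB) (γ : Fin M.ωB) :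
      ketTensor (ket (some (M.g ab.1 ab.2 (M.fB ab.2 γ))))
        ((((1 : Matrix A A ℂ) ⊗ₖ proj ab.1) ⊗ₖ (1 : Matrix (Fin M.ωA) (Fin M.ωA) ℂ)) ⊗ₖ
          (((1 : Matrix B B ℂ) ⊗ₖ proj ab.2) ⊗ₖ proj γ))
        (r, (((i, a), α), ((j, b), β))) (((i', a'), α'), ((j', b'), β')) =
      if γ = β then (if ab = (a, b) then
        (if ((((i, a), α), ((j, b), β)) : M.RegAB) = (((i', a'), α'), ((j', b'), β')) ∧
          r = some (M.g a b (M.fB b β)) then (1 : ℂ) else 0) else 0) else 0 := by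
    obtain ⟨c, d⟩ := ab
    simp only [ketTensor, ket, Matrix.of_apply, Pi.single_apply, Matrix.kroneckerMap_apply, proj,
      Matrix.single_apply, Matrix.one_apply, Prod.mk.injEq, ← ite_and, mul_ite, mul_one, mul_zero]
    refine if_congr ⟨?_, ?_⟩ rfl rfl
    · rintro ⟨⟨⟨⟨rfl, rfl⟩, ⟨rfl, rfl⟩, rfl⟩, rfl, ⟨rfl, rfl⟩, rfl⟩, rfl⟩
      simp
    · rintro ⟨rfl, ⟨rfl, rfl⟩, ⟨⟨⟨rfl, rfl⟩, rfl⟩, ⟨rfl, rfl⟩, rfl⟩, rfl⟩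
      simp
  simp only [V, Matrix.sum_apply, hterm, Finset.sum_ite_eq', Finset.mem_univ, if_true]

variable [Fintype SA] [Fintype SB]

lemma siftProj_mul_self : M.siftProj * M.siftProj = M.siftProj := by
  simp [siftProj_eq_diagonal]

lemma V_mul_siftProj : M.V * M.siftProj = M.V := by
  ext ⟨r, p⟩ q
  rw [siftProj_eq_diagonal, Matrix.mul_diagonal, V_apply]
  split_ifs <;> grind

/-- `V` is an isometry on the kept subspace: it only appends a key symbol. -/
lemma conjTranspose_V_mul_V : M.V.conjTranspose * M.V = M.siftProj := by
  ext p q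
  rw [siftProj_eq_diagonal, Matrix.mul_apply, Fintype.sum_prod_type, Finset.sum_comm,
    Finset.sum_eq_single p]
  · simp only [Matrix.conjTranspose_apply, V_apply, Matrix.diagonal_apply]
    rw [Finset.sum_eq_single (some (M.g p.1.1.2 p.2.1.2 (M.fB p.2.1.2 p.2.2)))]
    · by_cases h : (p.1.1.2, p.2.1.2) ∈ M.kept <;> simp [h]
    · intro r _ hr; simp [hr]
    · simp
  · intro p' _ hp'
    refine Finset.sum_eq_zero fun r _ => ?_
    simp [V_apply, hp']
  · simp

lemma VK_mul_siftProj : M.VK * M.siftProj = M.V := by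
  rw [VK, Matrix.add_mul, Matrix.mul_assoc, siftProj_mul_self, V_mul_siftProj, ketTensor_mul,
    Matrix.sub_mul, Matrix.one_mul,
    siftProj_mul_self, sub_self]
  ext p q
  simp [ketTensor]

lemma VK_mul_one_sub_siftProj :
    M.VK * (1 - M.siftProj) = ketTensor (ket none) (1 - M.siftProj) := by
  rw [Matrix.mul_sub, VK_mul_siftProj, Matrix.mul_one, VK, V_mul_siftProj, add_sub_cancel_left]

lemma trace_annMap (σ : Matrix (A × B) (A × B) ℂ) : (M.annMap σ).trace = σ.trace := by
  have hA := sum_conjTranspose_mul_kraus M.povmA M.annA M.fA M.krausA fun _ => rfl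
  have hB := sum_conjTranspose_mul_kraus M.povmB M.annB M.fB M.krausB fun _ => rfl
  have hAB : ∑ a, ∑ b, (M.krausA a ⊗ₖ M.krausB b).conjTranspose * (M.krausA a ⊗ₖ M.krausB b) =
      1 := by
    calc ∑ a, ∑ b, (M.krausA a ⊗ₖ M.krausB b).conjTranspose * (M.krausA a ⊗ₖ M.krausB b)
        = ∑ a, ∑ b, ((M.krausA a).conjTranspose * M.krausA a) ⊗ₖ
          ((M.krausB b).conjTranspose * M.krausB b) := by
          simp_rw [Matrix.conjTranspose_kronecker, ← Matrix.mul_kronecker_mul]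
      _ = (∑ a, (M.krausA a).conjTranspose * M.krausA a) ⊗ₖ
          (∑ b, (M.krausB b).conjTranspose * M.krausB b) := by
          ext p q
          simp only [Matrix.sum_apply, Matrix.kroneckerMap_apply, Finset.sum_mul_sum]
      _ = 1 := by rw [hA, hB, Matrix.one_kronecker_one]
  calc (M.annMap σ).trace
      = ((∑ a, ∑ b, (M.krausA a ⊗ₖ M.krausB b).conjTranspose *
          (M.krausA a ⊗ₖ M.krausB b)) * σ).trace := by
        simp_rw [annMap, Matrix.sum_mul, Matrix.trace_sum]
        refine Finset.sum_congr rfl fun a _ => Finset.sum_congr rfl fun b _ => ?_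
        rw [Matrix.trace_mul_comm, Matrix.mul_assoc]
    _ = σ.trace := by rw [hAB, Matrix.one_mul]

lemma posSemidef_annMap {σ : Matrix (A × B) (A × B) ℂ} (hσ : σ.PosSemidef) :
    (M.annMap σ).PosSemidef :=
  Matrix.posSemidef_sum _ fun _ _ => Matrix.posSemidef_sum _ fun _ _ =>
    hσ.mul_mul_conjTranspose_same _

/-- The projector `Π` in `𝒢` is redundant, because `V` already vanishes outside its range. -/
lemma G_eq (σ : Matrix (A × B) (A × B) ℂ) :
    M.G σ = M.V * M.annMap σ * M.V.conjTranspose := by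
  have h : M.siftProj * M.V.conjTranspose = M.V.conjTranspose := by
    conv_rhs => rw [← V_mul_siftProj, Matrix.conjTranspose_mul, (siftProj_isHermitian M).eq]
  rw [G, V_mul_siftProj, Matrix.mul_assoc _ M.siftProj, h]

lemma posSemidef_G {σ : Matrix (A × B) (A × B) ℂ} (hσ : σ.PosSemidef) : (M.G σ).PosSemidef := by
  rw [G_eq]
  exact (M.posSemidef_annMap hσ).mul_mul_conjTranspose_same _

lemma trace_G (σ : Matrix (A × B) (A × B) ℂ) :
    (M.G σ).trace = (M.annMap σ * M.siftProj).trace := by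
  rw [G_eq, Matrix.trace_mul_comm, ← Matrix.mul_assoc, conjTranspose_V_mul_V, Matrix.trace_mul_comm]

/-- The trace defining the sifting probability is real, being that of a positive operator. -/
lemma trace_G_eq_pPass {σ : Matrix (A × B) (A × B) ℂ} (hσ : σ.PosSemidef) :
    (M.G σ).trace = (M.pPass σ : ℂ) := by
  have h := (Complex.nonneg_iff.1 (M.posSemidef_G hσ).trace_nonneg).2
  rw [pPass, ← trace_G]
  exact Complex.ext rfl h.symm

lemma pPass_nonneg {σ : Matrix (A × B) (A × B) ℂ} (hσ : σ.PosSemidef) : 0 ≤ M.pPass σ := by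
  rw [pPass, ← trace_G]
  exact (Complex.nonneg_iff.1 (M.posSemidef_G hσ).trace_nonneg).1

/-! ### Kept and discarded parts -/

/-- The unnormalized state of the discarded rounds,
`|⊥⟩⟨⊥|_R ⊗ (1 - Π) 𝒜(σ) (1 - Π)`. -/
def discarded (σ : Matrix (A × B) (A × B) ℂ) :
    Matrix (M.RegR × M.RegAB) (M.RegR × M.RegAB) ℂ :=
  proj (none : M.RegR) ⊗ₖ ((1 - M.siftProj) * M.annMap σ * (1 - M.siftProj))

lemma discarded_eq (σ : Matrix (A × B) (A × B) ℂ) :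
    M.discarded σ = (M.VK * (1 - M.siftProj)) * M.annMap σ *
      (M.VK * (1 - M.siftProj)).conjTranspose := by
  rw [VK_mul_one_sub_siftProj, ketTensor_mul, ketTensor_mul_conjTranspose,
    (one_sub_siftProj_isHermitian M).eq, discarded]

lemma posSemidef_discarded {σ : Matrix (A × B) (A × B) ℂ} (hσ : σ.PosSemidef) :
    (M.discarded σ).PosSemidef := by
  rw [discarded_eq]
  exact (M.posSemidef_annMap hσ).mul_mul_conjTranspose_same _

lemma trace_discarded {σ : Matrix (A × B) (A × B) ℂ} (hσ : IsDensity σ) :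
    (M.discarded σ).trace = ((1 - M.pPass σ : ℝ) : ℂ) := by
  have hsq : (1 - M.siftProj) * (1 - M.siftProj) = 1 - M.siftProj := by
    rw [Matrix.mul_sub, Matrix.sub_mul, Matrix.sub_mul, siftProj_mul_self]; simp
  have hproj : (proj (none : M.RegR)).trace = 1 := by simp [proj]
  rw [discarded, Matrix.trace_kronecker, hproj, one_mul, Matrix.trace_mul_comm, ← Matrix.mul_assoc,
    hsq, Matrix.sub_mul, Matrix.one_mul, Matrix.trace_sub, trace_annMap, hσ.2,
    Matrix.trace_mul_comm, ← trace_G, trace_G_eq_pPass M hσ.1]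
  simp

/-- This includes the case `p_pass = 0`, where `𝒢(σ)` is positive with trace `0`, hence zero. -/
lemma pPass_smul_rhoK {σ : Matrix (A × B) (A × B) ℂ} (hσ : σ.PosSemidef) :
    (M.pPass σ : ℂ) • M.rhoK σ = M.G σ := by
  rcases eq_or_ne (M.pPass σ : ℂ) 0 with h | h
  · have hG : M.G σ = 0 :=
      (M.posSemidef_G hσ).trace_eq_zero_iff.1 ((M.trace_G_eq_pPass hσ).trans h)
    rw [h, zero_smul, hG]
  · rw [rhoK, smul_smul, mul_inv_cancel₀ h, one_smul]

lemma one_sub_pPass_smul_rhoD {σ : Matrix (A × B) (A × B) ℂ} (hσ : IsDensity σ) :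
    ((1 - M.pPass σ : ℝ) : ℂ) • M.rhoD σ = M.discarded σ := by
  rcases eq_or_ne ((1 - M.pPass σ : ℝ) : ℂ) 0 with h | h
  · have hD : M.discarded σ = 0 :=
      (M.posSemidef_discarded hσ.1).trace_eq_zero_iff.1 ((M.trace_discarded hσ).trans h)
    rw [h, zero_smul, hD]
  · rw [rhoD, smul_smul, mul_inv_cancel₀ h, one_smul, discarded]

lemma posSemidef_rhoK {σ : Matrix (A × B) (A × B) ℂ} (hσ : σ.PosSemidef) :
    (M.rhoK σ).PosSemidef := by
  rw [rhoK, ← Complex.ofReal_inv]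
  exact (M.posSemidef_G hσ).smul (by exact_mod_cast inv_nonneg.2 (M.pPass_nonneg hσ))

lemma pinch_discarded (σ : Matrix (A × B) (A × B) ℂ) :
    pinch (M.discarded σ) = M.discarded σ := by
  ext p q
  rw [pinch_apply, ite_eq_left_iff]
  intro h
  simp only [discarded, proj, Matrix.kroneckerMap_apply, Matrix.single_apply]
  grind

lemma pinch_rhoD (σ : Matrix (A × B) (A × B) ℂ) : pinch (M.rhoD σ) = M.rhoD σ := by
  have h : M.rhoD σ = (((1 - M.pPass σ : ℝ) : ℂ))⁻¹ • M.discarded σ := rfl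
  rw [h, pinch_smul, pinch_discarded]

lemma pinchKey_G (σ : Matrix (A × B) (A × B) ℂ) : M.pinchKey (M.G σ) = pinch (M.G σ) := by
  -- `V` never outputs the symbol `⊥`.
  have hV : keyProj M.RegAB (none : M.RegR) * M.V = 0 := by
    ext ⟨r, p⟩ q
    rw [keyProj_eq_diagonal, Matrix.diagonal_mul, V_apply]
    cases r <;> simp
  rw [pinch, Fintype.sum_option, G_eq, pinchKey]
  simp only [← Matrix.mul_assoc, hV, Matrix.zero_mul, zero_add]

/-! ### The state after announcement, sifting and key map -/

variable [Fintype E] [DecidableEq E]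

/-- Tracing out Eve's copies of the announcements turns the isometry `W_A ⊗ W_B` into the channel
`𝒜`. -/
lemma traceRight_rho1 (ρ : Matrix ((A × B) × E) ((A × B) × E) ℂ) :
    traceRight (M.rho1 ρ) = M.annMap (traceRight ρ) := by
  have hWA (x : M.RegA) (a : SA) (i : A) : M.WA (x, a) i = M.krausA a x i := by
    simp [WA, tensorKet, ket, Matrix.sum_apply, Pi.single_apply]
  have hWB (x : M.RegB) (b : SB) (i : B) : M.WB (x, b) i = M.krausB b x i := by
    simp [WB, tensorKet, ket, Matrix.sum_apply, Pi.single_apply]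
  have hstep (e : E) (a : SA) (b : SB) :
      braRight (m := M.RegE₁ E) M.RegAB ((e, a), b) * M.annStep E =
        (M.krausA a ⊗ₖ M.krausB b) * braRight (A × B) e := by
    ext x ⟨⟨i, j⟩, e'⟩
    rw [braRight_mul_apply, mul_braRight_apply]
    simp only [annStep, Matrix.submatrix_apply, Matrix.kroneckerMap_apply, hWA, hWB,
      Matrix.one_apply, id, mul_ite, mul_one, mul_zero, eq_comm]
  rw [traceRight_eq_sum_braRight, traceRight_eq_sum_braRight ρ, annMap, Fintype.sum_prod_type,
    Fintype.sum_prod_type]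
  simp_rw [Matrix.mul_sum, Matrix.sum_mul]
  refine Finset.sum_comm.trans ?_
  refine Finset.sum_congr rfl fun a _ => ?_
  rw [Finset.sum_comm]
  refine Finset.sum_congr rfl fun b _ => Finset.sum_congr rfl fun e _ => ?_
  have h := hstep e a b
  calc _ = (braRight (m := M.RegE₁ E) M.RegAB ((e, a), b) * M.annStep E) * ρ *
        (braRight (m := M.RegE₁ E) M.RegAB ((e, a), b) * M.annStep E).conjTranspose := by
        simp only [rho1, Matrix.conjTranspose_mul, Matrix.mul_assoc]
    _ = _ := by rw [h]; simp only [Matrix.conjTranspose_mul, Matrix.mul_assoc]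

/-- Tracing out Eve's copy of the sifting decision removes the coherences between kept and
discarded rounds. -/
lemma traceRight_rho2 (ρ : Matrix ((A × B) × E) ((A × B) × E) ℂ) :
    traceRight (M.rho2 ρ) =
      (M.siftProj * M.annMap (traceRight ρ) * M.siftProj) ⊗ₖ proj true +
        ((1 - M.siftProj) * M.annMap (traceRight ρ) * (1 - M.siftProj)) ⊗ₖ proj false := by
  let Q : RegS → Matrix M.RegAB M.RegAB ℂ := fun s => if s then M.siftProj else 1 - M.siftProj
  have hstep (e : M.RegE₁ E) (s : RegS) :
      braRight (m := M.RegE E) (M.RegAB × RegS) (e, s) * M.siftStep E =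
        tensorKet (Q s) (ket s) * braRight M.RegAB e := by
    ext ⟨x, t⟩ ⟨y, e'⟩
    rw [braRight_mul_apply, mul_braRight_apply]
    simp only [siftStep, VS, tensorKet, Q, Matrix.submatrix_apply, Matrix.kroneckerMap_apply,
      Matrix.one_apply, Matrix.add_apply, Matrix.of_apply, id, mul_ite, mul_one, mul_zero,
      eq_comm (a := e)]
    cases s <;> cases t <;> simp [ket]
  have hQ (s : RegS) : (Q s).conjTranspose = Q s := by
    cases s
    exacts [M.one_sub_siftProj_isHermitian, M.siftProj_isHermitian]
  have hs (s : RegS) : ∑ e : M.RegE₁ E,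
      braRight (m := M.RegE E) (M.RegAB × RegS) (e, s) * M.rho2 ρ *
        (braRight (m := M.RegE E) (M.RegAB × RegS) (e, s)).conjTranspose =
      (Q s * M.annMap (traceRight ρ) * Q s) ⊗ₖ proj s := by
    calc _ = ∑ e : M.RegE₁ E, tensorKet (Q s) (ket s) *
          (braRight M.RegAB e * M.rho1 ρ * (braRight M.RegAB e).conjTranspose) *
          (tensorKet (Q s) (ket s)).conjTranspose := by
          refine Finset.sum_congr rfl fun e _ => ?_
          calc _ = (braRight (m := M.RegE E) (M.RegAB × RegS) (e, s) * M.siftStep E) * M.rho1 ρ *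
                (braRight (m := M.RegE E) (M.RegAB × RegS) (e, s) *
                  M.siftStep E).conjTranspose := by
                simp only [rho2, Matrix.conjTranspose_mul, Matrix.mul_assoc]
            _ = _ := by rw [hstep]; simp only [Matrix.conjTranspose_mul, Matrix.mul_assoc]
      _ = _ := by
          rw [← Matrix.sum_mul, ← Matrix.mul_sum, ← traceRight_eq_sum_braRight, traceRight_rho1,
            tensorKet_mul, tensorKet_mul_conjTranspose, hQ]
  rw [traceRight_eq_sum_braRight, Fintype.sum_prod_type, Finset.sum_comm, Fintype.sum_bool, hs, hs]
  rfl

/-- Block form of the final state without Eve's registers. Eve's copies of the announcements and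
of the sifting decision dephase the corresponding registers. -/
lemma rhoRABS_eq (ρ : Matrix ((A × B) × E) ((A × B) × E) ℂ) :
    M.rhoRABS ρ = M.withS (M.G (traceRight ρ)) true +
      M.withS (M.discarded (traceRight ρ)) false := by
  -- `K` is the key isometry on `[A][B]S`; contracting Eve's registers commutes with it.
  let K : Matrix (M.RegR × (M.RegAB × RegS)) (M.RegAB × RegS) ℂ :=
    (M.VK ⊗ₖ (1 : Matrix RegS RegS ℂ)).submatrix (fun p => ((p.1, p.2.1), p.2.2)) id
  have hstep (e : M.RegE E) : braRight (M.RegR × (M.RegAB × RegS)) e * M.keyStep E =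
      K * braRight (M.RegAB × RegS) e := by
    ext x ⟨y, e'⟩
    rw [braRight_mul_apply, mul_braRight_apply]
    simp only [keyStep, K, Matrix.submatrix_apply, Matrix.kroneckerMap_apply, Matrix.one_apply,
      id, mul_ite, mul_one, mul_zero, eq_comm (a := e)]
  have hK (Z : Matrix M.RegAB M.RegAB ℂ) (s : RegS) :
      K * (Z ⊗ₖ proj s) * K.conjTranspose =
        M.withS (M.VK * Z * M.VK.conjTranspose) s := by
    have h : (M.VK ⊗ₖ (1 : Matrix RegS RegS ℂ)) * (Z ⊗ₖ proj s) *
        (M.VK ⊗ₖ (1 : Matrix RegS RegS ℂ)).conjTranspose =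
        (M.VK * Z * M.VK.conjTranspose) ⊗ₖ proj s := by
      rw [Matrix.conjTranspose_kronecker, ← Matrix.mul_kronecker_mul, ← Matrix.mul_kronecker_mul]
      simp
    rw [withS, ← h]
    rfl
  have hG : M.VK * (M.siftProj * M.annMap (traceRight ρ) * M.siftProj) * M.VK.conjTranspose =
      M.G (traceRight ρ) := by
    rw [G_eq, ← VK_mul_siftProj, Matrix.conjTranspose_mul, (siftProj_isHermitian M).eq]
    simp only [Matrix.mul_assoc]
  have hD : M.VK * ((1 - M.siftProj) * M.annMap (traceRight ρ) * (1 - M.siftProj)) *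
      M.VK.conjTranspose = M.discarded (traceRight ρ) := by
    rw [discarded_eq, Matrix.conjTranspose_mul, (one_sub_siftProj_isHermitian M).eq]
    simp only [Matrix.mul_assoc]
  calc M.rhoRABS ρ
      = ∑ e : M.RegE E, K * (braRight (M.RegAB × RegS) e * M.rho2 ρ *
          (braRight (M.RegAB × RegS) e).conjTranspose) * K.conjTranspose := by
        rw [rhoRABS, traceRight_eq_sum_braRight]
        refine Finset.sum_congr rfl fun e _ => ?_
        calc _ = (braRight (M.RegR × (M.RegAB × RegS)) e * M.keyStep E) * M.rho2 ρ *
              (braRight (M.RegR × (M.RegAB × RegS)) e * M.keyStep E).conjTranspose := by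
              simp only [rho3, Matrix.conjTranspose_mul, Matrix.mul_assoc]
          _ = _ := by rw [hstep]; simp only [Matrix.conjTranspose_mul, Matrix.mul_assoc]
    _ = _ := by
        rw [← Matrix.sum_mul, ← Matrix.mul_sum, ← traceRight_eq_sum_braRight, traceRight_rho2,
          Matrix.mul_add, Matrix.add_mul, hK, hK, hG, hD]

lemma pinch_withS_add (τ υ : Matrix (M.RegR × M.RegAB) (M.RegR × M.RegAB) ℂ) :
    pinch (M.withS τ true + M.withS υ false) =
      M.withS (pinch τ) true + M.withS (pinch υ) false := by
  ext p q
  simp only [withS, pinch_apply, Matrix.add_apply, Matrix.submatrix_apply,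
    Matrix.kroneckerMap_apply]
  split_ifs <;> simp

lemma vnEntropy_withS_add {τ υ : Matrix (M.RegR × M.RegAB) (M.RegR × M.RegAB) ℂ}
    (hτ : τ.IsHermitian) (hυ : υ.IsHermitian) :
    vnEntropy (M.withS τ true + M.withS υ false) = vnEntropy τ + vnEntropy υ :=
  vnEntropy_kronecker_proj_add hτ hυ (e := (Equiv.prodAssoc M.RegR M.RegAB RegS).symm)

lemma rho3_pureState (ψ : (A × B) × E → ℂ) :
    M.rho3 (pureState ψ) = pureState
      ((M.keyStep E).mulVec ((M.siftStep E).mulVec ((M.annStep E).mulVec ψ))) := by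
  rw [rho3, rho2, rho1, mul_pureState_mul_conjTranspose, mul_pureState_mul_conjTranspose,
    mul_pureState_mul_conjTranspose]

/-- Only the kept part contributes to the relative entropy of coherence of the final state: the
pinching respects the sifting register and leaves the discarded part unchanged. -/
lemma relEntropy_pinch_rhoRABS {ρ : Matrix ((A × B) × E) ((A × B) × E) ℂ}
    (hρ : (traceRight ρ).PosSemidef) :
    relEntropy (M.rhoRABS ρ) (pinch (M.rhoRABS ρ)) =
      relEntropy (M.G (traceRight ρ)) (pinch (M.G (traceRight ρ))) := by
  have hG := M.posSemidef_G hρ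
  have hD := M.posSemidef_discarded hρ
  have hτ : (M.rhoRABS ρ).PosSemidef := by
    rw [rhoRABS_eq]
    exact ((hG.kronecker (posSemidef_proj true)).submatrix _).add
      ((hD.kronecker (posSemidef_proj false)).submatrix _)
  rw [relEntropy_pinch hτ, relEntropy_pinch hG, rhoRABS_eq, pinch_withS_add, pinch_discarded,
    vnEntropy_withS_add M hG.isHermitian hD.isHermitian,
    vnEntropy_withS_add M (posSemidef_pinch hG).isHermitian hD.isHermitian]
  congr 1
  ring

end Round

end QKD

end

theorem mainTheorem1 {A B E SA SB X Y : Type*}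
    [Fintype A] [Fintype B] [Fintype E] [Fintype SA] [Fintype SB] [Fintype X] [Fintype Y]
    [DecidableEq A] [DecidableEq B] [DecidableEq E] [DecidableEq SA] [DecidableEq SB]
    (M : QKD.Round A B SA SB X Y)
    (ρAB : Matrix (A × B) (A × B) ℂ) (hρ : QKD.IsDensity ρAB)
    (ψ : (A × B) × E → ℂ) (hψ : QKD.traceRight (QKD.pureState ψ) = ρAB) :
    -- Eve's conditional entropy is the relative entropy of coherence of the key map on `ρ⁽³⁾`
    ((QKD.condEntropy (M.rho3 (QKD.pureState ψ)) : ℝ) : EReal) =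
        QKD.relEntropy (M.rhoRABS (QKD.pureState ψ)) (QKD.pinch (M.rhoRABS (QKD.pureState ψ))) ∧
    -- block form of `ρ⁽³⁾_{R[A][B]S}`
    (M.G ρAB).trace = (M.pPass ρAB : ℂ) ∧
    (M.annMap ρAB * M.siftProj).trace = (M.pPass ρAB : ℂ) ∧
    M.rhoRABS (QKD.pureState ψ) =
        (M.pPass ρAB : ℂ) • M.withS (M.rhoK ρAB) true +
        ((1 - M.pPass ρAB : ℝ) : ℂ) • M.withS (M.rhoD ρAB) false ∧
    -- the chain of equalities; discarded events do not contribute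
    QKD.relEntropy (M.rhoRABS (QKD.pureState ψ)) (QKD.pinch (M.rhoRABS (QKD.pureState ψ))) =
        (M.pPass ρAB : EReal) * QKD.relEntropy (M.rhoK ρAB) (QKD.pinch (M.rhoK ρAB)) +
        ((1 - M.pPass ρAB : ℝ) : EReal) *
          QKD.relEntropy (M.rhoD ρAB) (QKD.pinch (M.rhoD ρAB)) ∧
    QKD.pinch (M.rhoD ρAB) = M.rhoD ρAB ∧
    QKD.relEntropy (M.rhoD ρAB) (M.rhoD ρAB) = 0 ∧
    (M.pPass ρAB : EReal) * QKD.relEntropy (M.rhoK ρAB) (QKD.pinch (M.rhoK ρAB)) =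
        QKD.relEntropy (M.G ρAB) (QKD.pinch (M.G ρAB)) ∧
    -- the resulting formula for Eve's conditional entropy
    ((QKD.condEntropy (M.rho3 (QKD.pureState ψ)) : ℝ) : EReal) =
        QKD.relEntropy (M.G ρAB) (QKD.pinch (M.G ρAB)) ∧
    -- the symbol `⊥` can be dropped from the pinching
    M.pinchKey (M.G ρAB) = QKD.pinch (M.G ρAB) := by
  subst hψ
  have hcoh := M.relEntropy_pinch_rhoRABS hρ.1
  have hK : (M.pPass (QKD.traceRight (QKD.pureState ψ)) : EReal) *
      QKD.relEntropy (M.rhoK (QKD.traceRight (QKD.pureState ψ)))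
        (QKD.pinch (M.rhoK (QKD.traceRight (QKD.pureState ψ)))) =
      QKD.relEntropy (M.G (QKD.traceRight (QKD.pureState ψ)))
        (QKD.pinch (M.G (QKD.traceRight (QKD.pureState ψ)))) := by
    rw [← QKD.relEntropy_pinch_smul (M.posSemidef_rhoK hρ.1) (M.pPass_nonneg hρ.1),
      M.pPass_smul_rhoK hρ.1]
  have hcond : ((QKD.condEntropy (M.rho3 (QKD.pureState ψ)) : ℝ) : EReal) =
      QKD.relEntropy (M.rhoRABS (QKD.pureState ψ))
        (QKD.pinch (M.rhoRABS (QKD.pureState ψ))) := by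
    rw [QKD.Round.rhoRABS, M.rho3_pureState, QKD.condEntropy_pureState]
  refine ⟨hcond, M.trace_G_eq_pPass hρ.1, (M.trace_G _).symm.trans (M.trace_G_eq_pPass hρ.1),
    ?_, ?_, M.pinch_rhoD _, QKD.relEntropy_self _, hK, hcond.trans hcoh, M.pinchKey_G _⟩
  · rw [← M.withS_smul, ← M.withS_smul, M.pPass_smul_rhoK hρ.1, M.one_sub_pPass_smul_rhoD hρ,
      M.rhoRABS_eq]
  · rw [M.pinch_rhoD, QKD.relEntropy_self, mul_zero, add_zero, hK, hcoh]
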